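/- A Young function is $\Phi(t)=\int_0^t\varphi(s)\,ds$, $t\ge 0$, where $\varphi:[0,\infty)\to[0,\infty)$ is nondecreasing and right continuous, and $\varphi(t)=0$ if and only if $t=0$. Its complementary function is $\tilde\Phi(t)=\sup_{s>0}(st-\Phi(s))\in[0,\infty]$. We write $\Phi\in\Delta_2$ if $\Phi(2t)\le C\,\Phi(t)$ for some $C>1$ and all $t\ge 0$. For $F:[0,\infty)\to[0,\infty]$ we write $F\in\Delta'$ if $F(st)\le C\,F(s)F(t)$ for some $C>1$ and all $s,t\ge 0$. For $\Phi\in\Delta_2$ let $P_\Phi=\inf\{\alpha>0:\ \varphi(t)/\Phi(t)\le \alpha/t \text{ for all } t>0\}$. Let $C^1_c(\Omega)$ be the space of continuously differentiable functions with compact support in $\Omega$. Theorem. Let $N\ge 2$, and let $\Phi,\Psi\in\Delta_2$ be Young functions with $\tilde\Phi\in\Delta'$ and $$\int_1^\infty\Big(\frac{s}{\Phi(s)}\Big)^{\frac1{N-1}}ds<\infty .$$ Then for every $m\in\mathbb{R}$ there is a constant $C_1>0$, depending only on $N,\Phi,\Psi$ and $m$, such that for every bounded open set $\Omega\subset\mathbb{R}^N$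 with $|\Omega|\le m$ and every $g\in L^1(\Omega)$, the integrals below are finite and $$\Psi^{-1}\Big(\int_\Omega |g|\,\Psi(|u|)\,dx\Big)\le C_1C_2\,\Phi^{-1}\Big(\int_\Omega\Phi(|\nabla u|)\,dx\Big)\qquad\text{for all }u\in C^1_c(\Omega),$$ where $C_2=\max\big\{\|g\|_{L^1(\Omega)},\|g\|_{L^1(\Omega)}^{1/P_\Psi}\big\}$. If in addition $\tilde\Psi\in\Delta'$, the same holds with $C_2=\Psi^{-1}\big(\|g\|_{L^1(\Omega)}\big)$. -/

import Mathlib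

open MeasureTheory Set
open scoped ENNReal NNReal Gradient

/-- The data of a (finite) Young function: a nondecreasing right continuous function `φ` on
`[0, ∞)` with `φ t = 0` if and only if `t = 0`. Only the values on `[0, ∞)` matter. -/
structure YoungFunction where
  /-- the density `φ = Φ'` -/
  φ : ℝ → ℝ
  monotone' : MonotoneOn φ (Ici 0)
  rightCont' : ∀ t : ℝ, 0 ≤ t → ContinuousWithinAt φ (Ici t) t
  eq_zero_iff' : ∀ t : ℝ, 0 ≤ t → (φ t = 0 ↔ t = 0)

namespace YoungFunction

/-- The Young function itself: `Φ t = ∫₀ᵗ φ`, for `t ≥ 0`. -/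
noncomputable def val (Φ : YoungFunction) (t : ℝ) : ℝ := ∫ s in (0 : ℝ)..t, Φ.φ s

/-- The inverse of the increasing bijection `Φ : [0, ∞) → [0, ∞)`, for `y ≥ 0`. -/
noncomputable def inv (Φ : YoungFunction) (y : ℝ) : ℝ := sSup {t : ℝ | 0 ≤ t ∧ Φ.val t ≤ y}

/-- The complementary function `t ↦ sup {s t - Φ s : s > 0}`. It is `[0, ∞]`-valued, as it may be
infinite when `φ` is bounded. The supremum is nonnegative (let `s → 0`), so that replacing
`s t - Φ s` by its positive part does not change it. -/
noncomputable def compl (Φ : YoungFunction) (t : ℝ) : ℝ≥0∞ :=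
  ⨆ (s : ℝ) (_ : 0 < s), ENNReal.ofReal (s * t - Φ.val s)

/-- The `Δ₂` condition. -/
def Delta2 (Φ : YoungFunction) : Prop :=
  ∃ C : ℝ, 1 < C ∧ ∀ t : ℝ, 0 ≤ t → Φ.val (2 * t) ≤ C * Φ.val t

/-- The index `P_Φ`: the infimum of all `α > 0` with `φ t / Φ t ≤ α / t` for all `t > 0`. -/
noncomputable def index (Φ : YoungFunction) : ℝ :=
  sInf {α : ℝ | 0 < α ∧ ∀ t : ℝ, 0 < t → Φ.φ t / Φ.val t ≤ α / t}

end YoungFunction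

/-- The `Δ'` condition, for a `[0, ∞]`-valued function on `[0, ∞)`. -/
def DeltaPrime (F : ℝ → ℝ≥0∞) : Prop :=
  ∃ C : ℝ≥0, 1 < C ∧ ∀ s t : ℝ, 0 ≤ s → 0 ≤ t → F (s * t) ≤ C * F s * F t

/-- The condition `∫₁^∞ (s / Φ s)^{1/(N-1)} ds < ∞`. -/
def SupercriticalGrowth (N : ℕ) (Φ : YoungFunction) : Prop :=
  IntegrableOn (fun s : ℝ => (s / Φ.val s) ^ (1 / ((N : ℝ) - 1))) (Ioi 1)

/-- The space `C¹_c(Ω)`; functions are extended by zero outside `Ω`. -/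
def C1c {N : ℕ} (Ω : Set (EuclideanSpace ℝ (Fin N))) : Set (EuclideanSpace ℝ (Fin N) → ℝ) :=
  {u | ContDiff ℝ 1 u ∧ HasCompactSupport u ∧ tsupport u ⊆ Ω}

/-- The weighted modular inequality
`Ψ⁻¹ (∫_Ω |g| Ψ(|u|)) ≤ C Φ⁻¹ (∫_Ω Φ(|∇u|))` for all `u ∈ C¹_c(Ω)`,
together with the finiteness of the two integrals. -/
def ModularInequality {N : ℕ} (Φ Ψ : YoungFunction) (Ω : Set (EuclideanSpace ℝ (Fin N)))
    (g : EuclideanSpace ℝ (Fin N) → ℝ) (C : ℝ) : Prop :=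
  ∀ u ∈ C1c Ω,
    IntegrableOn (fun x => |g x| * Ψ.val |u x|) Ω ∧
    IntegrableOn (fun x => Φ.val ‖∇ u x‖) Ω ∧
    Ψ.inv (∫ x in Ω, |g x| * Ψ.val |u x|) ≤ C * Φ.inv (∫ x in Ω, Φ.val ‖∇ u x‖)

/-!
The left side only sees `g` through its `L¹` norm once `u` is bounded: if `|u| ≤ B`, then
`Ψ⁻¹ (∫ |g| Ψ(|u|)) ≤ Ψ⁻¹ (‖g‖₁ Ψ B)`. The factor `‖g‖₁` is pulled out of `Ψ⁻¹` in one of two ways.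
For `‖g‖₁ ≥ 1` convexity suffices, and for `‖g‖₁ ≤ 1` the function `Ψ t / t ^ P` is nonincreasing,
where `P` is the index of `Ψ` (`YoungFunction.inv_mul_val_le_max`). If the complementary function of
`Ψ` satisfies `Δ'`, then Young's inequality gives `Ψ s Ψ t ≤ Ψ (K s t)`
(`YoungFunction.exists_val_mul_val_le`), hence `Ψ⁻¹ (a Ψ t) ≤ K Ψ⁻¹(a) t`
(`YoungFunction.exists_inv_mul_val_le`).

Thus everything rests on the bound `|u| ≤ K Φ⁻¹ (∫ Φ(|∇u|))`. By the same supermultiplicativity,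
now of `Φ`, it follows from the Luxemburg form: `∫ Φ(|∇u| / l) ≤ 1` implies `|u| ≤ K l`
(`YoungFunction.exists_forall_abs_le`). To prove the latter, set `a = |∇u| / l` and integrate
along rays in polar coordinates, so that `|u(x)| / l` is at most the mean over directions `ω` of
`∫₀^∞ a(x + rω) dr`. With `h σ = (σ / Φ σ) ^ (1 / (N - 1))`, which is nonincreasing, and
`s(r) = |{σ > 0 : r < h σ}|`, one has `a ≤ r ^ (N - 1) Φ(a) + s(r)` for all `a ≥ 0` and `r > 0`:
if `a > s(r)` then `h a ≤ r`, which says `a ≤ r ^ (N - 1) Φ(a)`. The first term integrates in polar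
coordinates to `∫ Φ(a) ≤ 1`, and `∫₀¹ s(r) dr ≤ 1 + ∫₁^∞ h < ∞` is exactly the growth condition.
For `r ≥ 1` the bound `a ≤ Φ(a) / Φ(1) + 1` on the set `Ω` of finite measure is enough.
-/

/-! ### Young functions -/

namespace YoungFunction

variable (Φ : YoungFunction)

lemma φ_zero : Φ.φ 0 = 0 := (Φ.eq_zero_iff' 0 le_rfl).2 rfl

lemma φ_nonneg {t : ℝ} (ht : 0 ≤ t) : 0 ≤ Φ.φ t := by
  simpa [Φ.φ_zero] using Φ.monotone' (mem_Ici.2 le_rfl) (mem_Ici.2 ht) ht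

lemma φ_pos {t : ℝ} (ht : 0 < t) : 0 < Φ.φ t :=
  lt_of_le_of_ne (Φ.φ_nonneg ht.le) fun h => ht.ne' ((Φ.eq_zero_iff' t ht.le).1 h.symm)

lemma intervalIntegrable_φ {s t : ℝ} (hs : 0 ≤ s) (ht : 0 ≤ t) :
    IntervalIntegrable Φ.φ volume s t :=
  MonotoneOn.intervalIntegrable fun _ ha _ hb hab =>
    Φ.monotone' (le_trans (le_min hs ht) ha.1) (le_trans (le_min hs ht) hb.1) hab

@[simp] lemma val_zero : Φ.val 0 = 0 := by simp [val]

lemma val_sub_val {s t : ℝ} (hs : 0 ≤ s) (ht : 0 ≤ t) :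
    Φ.val t - Φ.val s = ∫ r in s..t, Φ.φ r :=
  intervalIntegral.integral_interval_sub_left (Φ.intervalIntegrable_φ le_rfl ht)
    (Φ.intervalIntegrable_φ le_rfl hs)

lemma mul_φ_le_val_sub {s t : ℝ} (hs : 0 ≤ s) (hst : s ≤ t) :
    (t - s) * Φ.φ s ≤ Φ.val t - Φ.val s := by
  have ht := hs.trans hst
  rw [Φ.val_sub_val hs ht, ← smul_eq_mul, ← intervalIntegral.integral_const]
  exact intervalIntegral.integral_mono_on hst (by simp) (Φ.intervalIntegrable_φ hs ht)
    fun r hr => Φ.monotone' hs (hs.trans hr.1) hr.1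

lemma val_sub_le_mul_φ {s t : ℝ} (hs : 0 ≤ s) (hst : s ≤ t) :
    Φ.val t - Φ.val s ≤ (t - s) * Φ.φ t := by
  have ht := hs.trans hst
  rw [Φ.val_sub_val hs ht, ← smul_eq_mul, ← intervalIntegral.integral_const]
  exact intervalIntegral.integral_mono_on hst (Φ.intervalIntegrable_φ hs ht) (by simp)
    fun r hr => Φ.monotone' (hs.trans hr.1) ht hr.2

lemma monotoneOn_val : MonotoneOn Φ.val (Ici 0) := fun s hs t _ hst => by
  have := Φ.mul_φ_le_val_sub hs hst
  have := mul_nonneg (sub_nonneg.2 hst) (Φ.φ_nonneg hs)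
  linarith

lemma val_nonneg {t : ℝ} (ht : 0 ≤ t) : 0 ≤ Φ.val t := by
  simpa using Φ.monotoneOn_val (mem_Ici.2 le_rfl) (mem_Ici.2 ht) ht

lemma val_le_mul_φ {t : ℝ} (ht : 0 ≤ t) : Φ.val t ≤ t * Φ.φ t := by
  simpa using Φ.val_sub_le_mul_φ le_rfl ht

lemma val_pos {t : ℝ} (ht : 0 < t) : 0 < Φ.val t := by
  have h := Φ.mul_φ_le_val_sub (half_pos ht).le (half_le_self ht.le)
  have := Φ.val_nonneg (half_pos ht).le
  have := mul_pos (half_pos ht) (Φ.φ_pos (half_pos ht))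
  have : t - t / 2 = t / 2 := by ring
  rw [this] at h
  linarith

lemma strictMonoOn_val : StrictMonoOn Φ.val (Ici 0) := fun s hs t ht hst => by
  rcases eq_or_lt_of_le (mem_Ici.1 hs) with h0 | h0
  · rw [← h0] at hst ⊢
    simpa using Φ.val_pos hst
  · have := Φ.mul_φ_le_val_sub hs hst.le
    have := mul_pos (sub_pos.2 hst) (Φ.φ_pos h0)
    linarith

/-- The quotient `Φ t / t` is nondecreasing, written without division. -/
lemma mul_val_le_mul_val {s t : ℝ} (hs : 0 ≤ s) (hst : s ≤ t) :
    t * Φ.val s ≤ s * Φ.val t := by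
  have h1 := mul_le_mul_of_nonneg_left (Φ.mul_φ_le_val_sub hs hst) hs
  have h2 := mul_le_mul_of_nonneg_left (Φ.val_le_mul_φ hs) (sub_nonneg.2 hst)
  nlinarith

lemma mul_val_le_val_mul {a t : ℝ} (ha : 1 ≤ a) (ht : 0 ≤ t) : a * Φ.val t ≤ Φ.val (a * t) := by
  rcases eq_or_lt_of_le ht with rfl | h0
  · simp
  · have := Φ.mul_val_le_mul_val ht (le_mul_of_one_le_left ht ha)
    rw [mul_comm a t, mul_assoc] at this
    rw [mul_comm a t]
    exact le_of_mul_le_mul_left this h0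

lemma continuousOn_val {b : ℝ} : ContinuousOn Φ.val (Icc 0 b) := by
  rcases le_or_gt 0 b with hb | hb
  · rw [← uIcc_of_le hb]
    refine intervalIntegral.continuousOn_primitive_interval ?_
    rw [uIcc_of_le hb]
    exact (intervalIntegrable_iff_integrableOn_Icc_of_le hb).1 (Φ.intervalIntegrable_φ le_rfl hb)
  · simp [Icc_eq_empty_of_lt hb]

/-- Truncating the argument at `0` removes the arbitrary values of `φ` on the negative axis. -/
lemma measurable_val_max : Measurable fun t => Φ.val (max t 0) :=
  Monotone.measurable fun _ _ h =>
    Φ.monotoneOn_val (mem_Ici.2 (le_max_right _ _)) (mem_Ici.2 (le_max_right _ _))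
      (max_le_max h le_rfl)

lemma measurable_val_comp {α : Type*} [MeasurableSpace α] {f : α → ℝ} (hf : Measurable f)
    (h0 : ∀ x, 0 ≤ f x) : Measurable fun x => Φ.val (f x) := by
  simpa only [Function.comp_def, max_eq_left (h0 _)] using Φ.measurable_val_max.comp hf

lemma hasDerivWithinAt_val {t : ℝ} (ht : 0 ≤ t) :
    HasDerivWithinAt Φ.val (Φ.φ t) (Ici t) t := by
  refine intervalIntegral.integral_hasDerivWithinAt_right (Φ.intervalIntegrable_φ le_rfl ht)
    (t := Ioi t) ?_ ((Φ.rightCont' t ht).mono Ioi_subset_Ici_self)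
  refine ⟨Ioi t, self_mem_nhdsWithin, ?_⟩
  exact (aemeasurable_restrict_of_monotoneOn measurableSet_Ioi
    (Φ.monotone'.mono fun s hs => ht.trans (le_of_lt hs))).aestronglyMeasurable

/-! ### The inverse of a Young function -/

lemma exists_lt_val (y : ℝ) : ∃ t : ℝ, 0 < t ∧ y < Φ.val t := by
  have h1 := Φ.val_pos one_pos
  refine ⟨max 1 (y / Φ.val 1 + 1), by positivity, ?_⟩
  have h := Φ.mul_val_le_val_mul (le_max_left 1 (y / Φ.val 1 + 1)) zero_le_one
  have h2 := mul_le_mul_of_nonneg_right (le_max_right 1 (y / Φ.val 1 + 1)) h1.le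
  rw [add_mul, div_mul_cancel₀ _ h1.ne'] at h2
  rw [mul_one] at h
  linarith

lemma le_of_val_le_val {s t : ℝ} (hs : 0 ≤ s) (ht : 0 ≤ t) (h : Φ.val s ≤ Φ.val t) : s ≤ t :=
  (Φ.strictMonoOn_val.le_iff_le hs ht).1 h

lemma bddAbove_inv (y : ℝ) : BddAbove {t : ℝ | 0 ≤ t ∧ Φ.val t ≤ y} := by
  obtain ⟨b, hb, hyb⟩ := Φ.exists_lt_val y
  exact ⟨b, fun t ht => Φ.le_of_val_le_val ht.1 hb.le (ht.2.trans hyb.le)⟩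

lemma inv_nonneg (y : ℝ) : 0 ≤ Φ.inv y := Real.sSup_nonneg fun _ h => h.1

lemma lt_val_of_inv_lt {y t : ℝ} (h : Φ.inv y < t) : y < Φ.val t := by
  by_contra! hc
  exact h.not_ge (le_csSup (Φ.bddAbove_inv y) ⟨(Φ.inv_nonneg y).trans h.le, hc⟩)

lemma inv_le_of_le_val {y t : ℝ} (ht : 0 ≤ t) (h : y ≤ Φ.val t) : Φ.inv y ≤ t :=
  Real.sSup_le (fun _ hs => Φ.le_of_val_le_val hs.1 ht (hs.2.trans h)) ht

lemma inv_mono {y z : ℝ} (hy : 0 ≤ y) (h : y ≤ z) : Φ.inv y ≤ Φ.inv z :=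
  csSup_le_csSup (Φ.bddAbove_inv z) ⟨0, le_rfl, by simpa using hy⟩ fun _ ht => ⟨ht.1, ht.2.trans h⟩

/-! ### The index of a Young function -/

lemma index_set_nonempty (h : Φ.Delta2) :
    {α : ℝ | 0 < α ∧ ∀ t : ℝ, 0 < t → Φ.φ t / Φ.val t ≤ α / t}.Nonempty := by
  obtain ⟨C, hC, hC2⟩ := h
  refine ⟨C, by linarith, fun t ht => ?_⟩
  have h1 := Φ.mul_φ_le_val_sub ht.le (by linarith : t ≤ 2 * t)
  have h2 := hC2 t ht.le
  have h3 := Φ.val_pos ht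
  rw [div_le_div_iff₀ h3 ht]
  nlinarith

lemma one_le_of_mem_index_set {α : ℝ}
    (hα : 0 < α ∧ ∀ t : ℝ, 0 < t → Φ.φ t / Φ.val t ≤ α / t) : 1 ≤ α := by
  have h := hα.2 1 one_pos
  rw [div_le_div_iff₀ (Φ.val_pos one_pos) one_pos] at h
  have := Φ.val_le_mul_φ zero_le_one
  have := Φ.val_pos one_pos
  nlinarith

lemma one_le_index (h : Φ.Delta2) : 1 ≤ Φ.index :=
  le_csInf (Φ.index_set_nonempty h) fun _ hα => Φ.one_le_of_mem_index_set hα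

lemma mul_φ_le_index_mul_val (h : Φ.Delta2) {t : ℝ} (ht : 0 < t) :
    t * Φ.φ t ≤ Φ.index * Φ.val t := by
  have h3 := Φ.val_pos ht
  rw [← div_le_iff₀ h3]
  refine le_csInf (Φ.index_set_nonempty h) fun α hα => ?_
  have := hα.2 t ht
  rw [div_le_div_iff₀ h3 ht] at this
  rw [div_le_iff₀ h3]
  linarith

/-- The quotient `Φ t / t ^ P`, where `P` is the index, is nonincreasing: its right derivative is
nonpositive. -/
lemma val_mul_rpow_neg_le (h : Φ.Delta2) {s t : ℝ} (hs : 0 < s) (hst : s ≤ t) :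
    Φ.val t * t ^ (-Φ.index) ≤ Φ.val s * s ^ (-Φ.index) := by
  refine image_le_of_deriv_right_le_deriv_boundary (a := s) (b := t)
    (f := fun r => Φ.val r * r ^ (-Φ.index))
    (f' := fun r => Φ.φ r * r ^ (-Φ.index) + Φ.val r * (-Φ.index * r ^ (-Φ.index - 1)))
    (B := fun _ => Φ.val s * s ^ (-Φ.index)) (B' := fun _ => 0)
    ?_ ?_ le_rfl continuousOn_const (fun _ _ => hasDerivWithinAt_const _ _ _) ?_ ⟨hst, le_rfl⟩
  · refine (Φ.continuousOn_val.mono (Icc_subset_Icc_left hs.le)).mul ?_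
    exact continuousOn_id.rpow_const fun r hr => Or.inl (hs.trans_le hr.1).ne'
  · intro r hr
    have hr0 : 0 < r := hs.trans_le hr.1
    exact (Φ.hasDerivWithinAt_val hr0.le).mul
      (Real.hasDerivAt_rpow_const (Or.inl hr0.ne')).hasDerivWithinAt
  · intro r hr
    have hr0 : 0 < r := hs.trans_le hr.1
    have h1 := Φ.mul_φ_le_index_mul_val h hr0
    have h2 : r ^ (-Φ.index) = r * r ^ (-Φ.index - 1) := by
      rw [Real.rpow_sub_one hr0.ne']; field_simp
    have h3 : 0 < r ^ (-Φ.index - 1) := by positivity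
    rw [h2]
    nlinarith

lemma rpow_index_mul_val_le (h : Φ.Delta2) {b t : ℝ} (hb : 0 < b) (hb1 : b ≤ 1) (ht : 0 ≤ t) :
    b ^ Φ.index * Φ.val t ≤ Φ.val (b * t) := by
  rcases eq_or_lt_of_le ht with rfl | h0
  · simp
  · have h1 := Φ.val_mul_rpow_neg_le h (mul_pos hb h0) (mul_le_of_le_one_left ht hb1)
    rw [Real.mul_rpow hb.le ht, Real.rpow_neg hb.le, Real.rpow_neg ht] at h1
    have h2 : 0 < b ^ Φ.index := by positivity
    have h3 : 0 < t ^ Φ.index := by positivity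
    field_simp at h1
    linarith

lemma inv_mul_val_le_max (h : Φ.Delta2) {a t : ℝ} (ha : 0 ≤ a) (ht : 0 ≤ t) :
    Φ.inv (a * Φ.val t) ≤ max a (a ^ (1 / Φ.index)) * t := by
  rcases eq_or_lt_of_le ha with rfl | ha0
  · rw [zero_mul]
    exact (Φ.inv_le_of_le_val le_rfl (by simp)).trans (by positivity)
  rcases le_total 1 a with h1 | h1
  · refine (Φ.inv_le_of_le_val (by positivity) (Φ.mul_val_le_val_mul h1 ht)).trans ?_
    gcongr
    exact le_max_left _ _
  · have hP := Φ.one_le_index h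
    have hP0 : Φ.index ≠ 0 := by linarith
    have h2 := Φ.rpow_index_mul_val_le h (b := a ^ (1 / Φ.index)) (by positivity)
      (Real.rpow_le_one ha h1 (by positivity)) ht
    rw [← Real.rpow_mul ha, one_div_mul_cancel hP0, Real.rpow_one] at h2
    refine (Φ.inv_le_of_le_val (by positivity) h2).trans ?_
    gcongr
    exact le_max_right _ _

/-! ### The complementary function -/

lemma compl_φ_le {s : ℝ} (hs : 0 ≤ s) : Φ.compl (Φ.φ s) ≤ ENNReal.ofReal (s * Φ.φ s) := by
  refine iSup₂_le fun r hr => ENNReal.ofReal_le_ofReal ?_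
  rcases le_total r s with h | h
  · have := mul_le_mul_of_nonneg_right h (Φ.φ_nonneg hs)
    have := Φ.val_nonneg hr.le
    linarith
  · have := Φ.mul_φ_le_val_sub hs h
    have := Φ.val_nonneg hs
    linarith

lemma ofReal_le_compl {s : ℝ} (hs : 0 < s) (t : ℝ) :
    ENNReal.ofReal (s * t - Φ.val s) ≤ Φ.compl t :=
  le_iSup₂ (f := fun (s : ℝ) (_ : 0 < s) => ENNReal.ofReal (s * t - Φ.val s)) s hs

/-- If the complementary function is submultiplicative up to a constant, then `Φ` is
supermultiplicative up to a dilation. This is Young's inequality at the slope `φ s * φ t`. -/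
lemma exists_val_mul_val_le (h : DeltaPrime Φ.compl) :
    ∃ K : ℝ, 1 < K ∧ ∀ s t : ℝ, 0 ≤ s → 0 ≤ t → Φ.val s * Φ.val t ≤ Φ.val (K * (s * t)) := by
  obtain ⟨C, hC, hC2⟩ := h
  have hC1 : (1 : ℝ) < C := by exact_mod_cast hC
  refine ⟨C + 1, by linarith, fun s t hs ht => ?_⟩
  rcases eq_or_lt_of_le hs with rfl | hs0
  · simp
  rcases eq_or_lt_of_le ht with rfl | ht0
  · simp
  have hσ := Φ.φ_nonneg hs
  have hτ := Φ.φ_nonneg ht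
  have h1 : ENNReal.ofReal ((C + 1) * (s * t) * (Φ.φ s * Φ.φ t) - Φ.val ((C + 1) * (s * t)))
      ≤ ENNReal.ofReal (C * (s * Φ.φ s) * (t * Φ.φ t)) := by
    rw [ENNReal.ofReal_mul (by positivity), ENNReal.ofReal_mul (by positivity),
      ENNReal.ofReal_coe_nnreal]
    refine (Φ.ofReal_le_compl (by positivity) _).trans ((hC2 _ _ hσ hτ).trans ?_)
    gcongr
    · exact Φ.compl_φ_le hs
    · exact Φ.compl_φ_le ht
  rw [ENNReal.ofReal_le_ofReal_iff (by positivity)] at h1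
  have h2 := mul_le_mul (Φ.val_le_mul_φ hs) (Φ.val_le_mul_φ ht) (Φ.val_nonneg ht) (by positivity)
  nlinarith

lemma exists_inv_mul_val_le (h : DeltaPrime Φ.compl) :
    ∃ K : ℝ, 1 < K ∧ ∀ a t : ℝ, 0 ≤ t → Φ.inv (a * Φ.val t) ≤ K * (Φ.inv a * t) := by
  obtain ⟨K, hK, hK2⟩ := Φ.exists_val_mul_val_le h
  refine ⟨K, hK, fun a t ht => ?_⟩
  -- Any `T > Φ⁻¹ a` satisfies `a < Φ T`; the bound at `Φ⁻¹ a` follows in the limit.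
  have key : ∀ T, Φ.inv a < T → Φ.inv (a * Φ.val t) ≤ K * (T * t) := fun T hT => by
    have hT0 : 0 ≤ T := (Φ.inv_nonneg a).trans hT.le
    refine Φ.inv_le_of_le_val (by positivity) (le_trans ?_ (hK2 T t hT0 ht))
    exact mul_le_mul_of_nonneg_right (Φ.lt_val_of_inv_lt hT).le (Φ.val_nonneg ht)
  have hc : ContinuousWithinAt (fun T : ℝ => K * (T * t)) (Ioi (Φ.inv a)) (Φ.inv a) := by
    fun_prop
  exact ge_of_tendsto hc (eventually_nhdsWithin_of_forall key)

end YoungFunction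

/-! ### Integration in polar coordinates -/

section Polar

open Module

variable {E : Type*} [NormedAddCommGroup E] [NormedSpace ℝ E]

/-- The fundamental theorem of calculus along a ray, on which `u` eventually vanishes. -/
lemma enorm_le_lintegral_enorm_fderiv_ray {u : E → ℝ} (hu : ContDiff ℝ 1 u)
    (hc : HasCompactSupport u) (x : E) {ω : E} (hω : ‖ω‖ = 1) :
    ‖u x‖ₑ ≤ ∫⁻ r in Ioi (0 : ℝ), ‖fderiv ℝ u (x + r • ω)‖ₑ := by
  have hiso : Isometry fun t : ℝ => x - t • ω := Isometry.of_dist_eq fun s t => by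
    rw [dist_sub_left, dist_eq_norm, ← sub_smul, norm_smul, hω, mul_one, dist_eq_norm]
  have hf : ContDiff ℝ 1 fun t : ℝ => u (x - t • ω) := by fun_prop
  have hfc : HasCompactSupport fun t : ℝ => u (x - t • ω) :=
    hc.comp_isClosedEmbedding hiso.isClosedEmbedding
  have hd : ∀ t : ℝ, ‖deriv (fun t : ℝ => u (x - t • ω)) t‖ₑ ≤ ‖fderiv ℝ u (x - t • ω)‖ₑ := by
    intro t
    have h1 : HasDerivAt (fun t : ℝ => x - t • ω) (-((1 : ℝ) • ω)) t :=
      ((hasDerivAt_id t).smul_const ω).const_sub x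
    have h2 := ((hu.differentiable one_ne_zero _).hasFDerivAt.comp_hasDerivAt t h1).deriv
    rw [Function.comp_def] at h2
    rw [h2]
    refine enorm_le_iff_norm_le.2 ?_
    simpa [hω] using (fderiv ℝ u (x - t • ω)).le_opNorm (-((1 : ℝ) • ω))
  have h := hfc.enorm_le_lintegral_Ici_deriv hf 0
  simp only [zero_smul, sub_zero] at h
  refine h.trans ((lintegral_mono hd).trans_eq ?_)
  rw [← setLIntegral_congr Iio_ae_eq_Iic,
    ← (Measure.measurePreserving_neg volume).setLIntegral_comp_preimage_emb
      (MeasurableEquiv.neg ℝ).measurableEmbedding _ (Iio (0 : ℝ))]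
  simp

variable [MeasurableSpace E] [BorelSpace E] [FiniteDimensional ℝ E] [Nontrivial E]

lemma lintegral_eq_lintegral_toSphere (μ : Measure E) [μ.IsAddHaarMeasure] {G : E → ℝ≥0∞}
    (hG : Measurable G) :
    ∫⁻ x, G x ∂μ = ∫⁻ ω : Metric.sphere (0 : E) 1, (∫⁻ r in Ioi (0 : ℝ),
      ENNReal.ofReal (r ^ (finrank ℝ E - 1)) * G (r • (ω : E))) ∂μ.toSphere := by
  have hm : Measurable fun p : Metric.sphere (0 : E) 1 × Ioi (0 : ℝ) =>
      G ((p.2 : ℝ) • (p.1 : E)) := hG.comp (by fun_prop)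
  have h1 := μ.measurePreserving_homeomorphUnitSphereProd.lintegral_comp hm
  rw [lintegral_prod _ hm.aemeasurable] at h1
  rw [← lintegral_add_compl G (measurableSet_singleton (0 : E))]
  have h0 : ∫⁻ x in {0}, G x ∂μ = 0 := by simp
  rw [h0, zero_add, ← lintegral_subtype_comap (measurableSet_singleton (0 : E)).compl]
  calc _ = _ := ?_
    _ = _ := h1
    _ = _ := ?_
  · refine lintegral_congr fun y => ?_
    have : ‖(y : E)‖ ≠ 0 := norm_ne_zero_iff.2 y.2
    simp [smul_smul, this]
  · refine lintegral_congr fun ω => ?_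
    rw [Measure.volumeIoiPow, lintegral_withDensity_eq_lintegral_mul _ (by fun_prop) (by fun_prop),
      ← lintegral_subtype_comap measurableSet_Ioi]
    rfl

end Polar

/-! ### The supremum bound -/

namespace YoungFunction

variable (Φ : YoungFunction)

/-- The function `h σ = (σ / Φ σ) ^ (1 / (N - 1))`. -/
noncomputable def growth (N : ℕ) (σ : ℝ) : ℝ := (σ / Φ.val σ) ^ (1 / ((N : ℝ) - 1))

/-- The generalized inverse of the nonincreasing function `Φ.growth N`, as the measure of the
superlevel set. -/
noncomputable def growthInv (N : ℕ) (r : ℝ) : ℝ≥0∞ := volume {σ : ℝ | 0 < σ ∧ r < Φ.growth N σ}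

lemma measurableSet_growth (N : ℕ) :
    MeasurableSet {p : ℝ × ℝ | 0 < p.2 ∧ p.1 < Φ.growth N p.2} := by
  have h1 : Measurable fun σ : ℝ => (σ / Φ.val (max σ 0)) ^ (1 / ((N : ℝ) - 1)) :=
    (measurable_id.div Φ.measurable_val_max).pow_const _
  have h2 : {p : ℝ × ℝ | 0 < p.2 ∧ p.1 < Φ.growth N p.2} =
      {p : ℝ × ℝ | 0 < p.2} ∩
        {p : ℝ × ℝ | p.1 < (p.2 / Φ.val (max p.2 0)) ^ (1 / ((N : ℝ) - 1))} := by
    ext p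
    simp only [mem_ofPred_eq, mem_inter_iff, growth]
    refine and_congr_right fun h => ?_
    rw [max_eq_left h.le]
  rw [h2]
  exact (measurableSet_lt measurable_const measurable_snd).inter
    (measurableSet_lt measurable_fst (h1.comp measurable_snd))

lemma growth_le_growth (N : ℕ) (hN : 2 ≤ N) {s t : ℝ} (hs : 0 < s) (hst : s ≤ t) :
    Φ.growth N t ≤ Φ.growth N s := by
  have hN' : (2 : ℝ) ≤ N := by exact_mod_cast hN
  have ht := hs.trans_le hst
  refine Real.rpow_le_rpow (div_nonneg ht.le (Φ.val_nonneg ht.le)) ?_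
    (one_div_nonneg.2 (by linarith))
  rw [div_le_div_iff₀ (Φ.val_pos ht) (Φ.val_pos hs)]
  exact Φ.mul_val_le_mul_val hs.le hst

/-- By Tonelli's theorem the integral of the generalized inverse over `(0, 1)` is the integral of
`min 1 h`, which is finite by the growth condition. -/
lemma lintegral_growthInv_lt_top (N : ℕ) (h : SupercriticalGrowth N Φ) :
    ∫⁻ r in Ioo (0 : ℝ) 1, Φ.growthInv N r < ∞ := by
  have h1 : ∫⁻ r in Ioo (0 : ℝ) 1, Φ.growthInv N r =
      ∫⁻ σ, (volume.restrict (Ioo (0 : ℝ) 1)) {r | 0 < σ ∧ r < Φ.growth N σ} := by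
    have h2 := (Measure.prod_apply (μ := volume.restrict (Ioo (0 : ℝ) 1)) (ν := volume)
      (Φ.measurableSet_growth N)).symm
    rw [Measure.prod_apply_symm (Φ.measurableSet_growth N)] at h2
    exact h2
  rw [h1]
  have h2 : ∀ σ : ℝ, (volume.restrict (Ioo (0 : ℝ) 1)) {r | 0 < σ ∧ r < Φ.growth N σ} ≤
      (Ioc (0 : ℝ) 1).indicator 1 σ +
        (Ioi (1 : ℝ)).indicator (fun σ => ENNReal.ofReal (Φ.growth N σ)) σ := by
    intro σ
    rw [Measure.restrict_apply' measurableSet_Ioo]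
    by_cases hσ : 0 < σ
    · rcases le_or_gt σ 1 with h1 | h1
      · refine (measure_mono inter_subset_right).trans ?_
        simp [hσ, h1]
      · have : {r | 0 < σ ∧ r < Φ.growth N σ} ∩ Ioo 0 1 ⊆ Ioo 0 (Φ.growth N σ) :=
          fun r hr => ⟨hr.2.1, hr.1.2⟩
        refine (measure_mono this).trans ?_
        simp [h1, h1.not_ge]
    · simp [hσ]
  refine (lintegral_mono h2).trans_lt ?_
  rw [lintegral_add_left (by measurability), lintegral_indicator measurableSet_Ioi,
    lintegral_indicator measurableSet_Ioc]
  refine ENNReal.add_lt_top.2 ⟨by simp, ?_⟩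
  exact h.lintegral_lt_top

/-- Young's inequality against the kernel `r ^ (1 - N)`, with the explicit remainder `growthInv`:
either `a` is at most the remainder, or `a / Φ a ≤ r ^ (N - 1)`. -/
lemma ofReal_le_pow_mul_val_add (N : ℕ) (hN : 2 ≤ N) {a r : ℝ} (ha : 0 ≤ a) (hr : 0 < r) :
    ENNReal.ofReal a ≤
      ENNReal.ofReal (r ^ (N - 1)) * ENNReal.ofReal (Φ.val a) + Φ.growthInv N r := by
  have hN' : (2 : ℝ) ≤ N := by exact_mod_cast hN
  rcases eq_or_lt_of_le ha with rfl | ha0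
  · simp
  rcases lt_or_ge r (Φ.growth N a) with h | h
  · refine le_add_left ?_
    have : Ioc 0 a ⊆ {σ : ℝ | 0 < σ ∧ r < Φ.growth N σ} :=
      fun σ hσ => ⟨hσ.1, h.trans_le (Φ.growth_le_growth N hN hσ.1 hσ.2)⟩
    simpa [growthInv] using measure_mono (μ := volume) this
  · refine le_add_right ?_
    rw [← ENNReal.ofReal_mul (by positivity)]
    refine ENNReal.ofReal_le_ofReal ?_
    rw [← div_le_iff₀ (Φ.val_pos ha0)]
    have h0 : 0 ≤ a / Φ.val a := div_nonneg ha (Φ.val_nonneg ha)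
    have h1 := Real.rpow_le_rpow (Real.rpow_nonneg h0 _) h (by linarith : 0 ≤ (N : ℝ) - 1)
    rw [← Real.rpow_mul h0, one_div_mul_cancel (by linarith), Real.rpow_one] at h1
    rwa [← Real.rpow_natCast, Nat.cast_sub (by omega), Nat.cast_one]

lemma ofReal_le_val_div_add_one {a : ℝ} (ha : 0 ≤ a) :
    ENNReal.ofReal a ≤ ENNReal.ofReal (Φ.val 1)⁻¹ * ENNReal.ofReal (Φ.val a) + 1 := by
  have h1 := Φ.val_pos one_pos
  rw [← ENNReal.ofReal_mul (by positivity), ← ENNReal.ofReal_one,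
    ← ENNReal.ofReal_add (mul_nonneg (by positivity) (Φ.val_nonneg ha)) zero_le_one]
  refine ENNReal.ofReal_le_ofReal ?_
  have hv := Φ.val_nonneg ha
  rcases le_total a 1 with h | h
  · have : 0 ≤ (Φ.val 1)⁻¹ * Φ.val a := by positivity
    linarith
  · have := Φ.mul_val_le_val_mul h zero_le_one
    rw [mul_one, ← le_div_iff₀ h1, div_eq_inv_mul] at this
    linarith

end YoungFunction

/-- The supremum bound in Luxemburg form: if `∫ Φ (|∇u| / l) ≤ 1` then `|u| ≤ K l`. The fundamental
theorem of calculus along each ray from `x` is combined with `ofReal_le_pow_mul_val_add` for radii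
below `1`, where the remainder is integrable, and with the linear lower bound of `Φ` for larger
radii; the result is averaged over all directions. -/
theorem YoungFunction.exists_forall_abs_le (N : ℕ) (hN : 2 ≤ N) (Φ : YoungFunction)
    (hgrowth : SupercriticalGrowth N Φ) (m : ℝ) :
    ∃ K : ℝ, 0 < K ∧ ∀ Ω : Set (EuclideanSpace ℝ (Fin N)), MeasurableSet Ω →
      volume Ω ≤ ENNReal.ofReal m → ∀ u ∈ C1c Ω, ∀ l : ℝ, 0 < l →
        ∫⁻ x in Ω, ENNReal.ofReal (Φ.val (‖fderiv ℝ u x‖ / l)) ≤ 1 → ∀ x, |u x| ≤ K * l := by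
  have : Nonempty (Fin N) := ⟨⟨0, by omega⟩⟩
  set S : ℝ≥0∞ := (volume : Measure (EuclideanSpace ℝ (Fin N))).toSphere univ with hS
  set A : ℝ≥0∞ := ∫⁻ r in Ioo (0 : ℝ) 1, Φ.growthInv N r with hA
  set c : ℝ≥0∞ := ENNReal.ofReal (Φ.val 1)⁻¹ with hc
  have hS0 : S ≠ 0 := Measure.measure_univ_ne_zero.2 (Measure.toSphere_ne_zero _)
  have hSt : S ≠ ∞ := measure_ne_top _ _
  have hAt : A ≠ ∞ := (Φ.lintegral_growthInv_lt_top N hgrowth).ne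
  have hct : c ≠ ∞ := ENNReal.ofReal_ne_top
  set Q : ℝ≥0∞ := (1 + c + ENNReal.ofReal m + A * S) / S with hQ
  have hQt : Q ≠ ∞ := by
    refine ENNReal.div_ne_top (ENNReal.add_ne_top.2 ⟨ENNReal.add_ne_top.2 ⟨?_, ?_⟩, ?_⟩) hS0
    · exact ENNReal.add_ne_top.2 ⟨ENNReal.one_ne_top, hct⟩
    · exact ENNReal.ofReal_ne_top
    · exact ENNReal.mul_ne_top hAt hSt
  refine ⟨Q.toReal + 1, by positivity, fun Ω hΩ hm u hu l hl hint x => ?_⟩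
  obtain ⟨hu1, hu2, hu3⟩ := hu
  set a : EuclideanSpace ℝ (Fin N) → ℝ := fun y => ‖fderiv ℝ u y‖ / l with ha
  have ha0 : ∀ y, 0 ≤ a y := fun y => by positivity
  have hcont : Continuous a := (hu1.continuous_fderiv one_ne_zero).norm.div_const l
  have haΩ : ∀ y, y ∉ Ω → a y = 0 := fun y hy => by
    have : fderiv ℝ u y = 0 := by
      by_contra h
      exact hy (hu3 (support_fderiv_subset ℝ h))
    simp [ha, this]
  set H : EuclideanSpace ℝ (Fin N) → ℝ≥0∞ :=
    fun y => (1 + c) * ENNReal.ofReal (Φ.val (a y)) + 1 with hH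
  have hΦm : Measurable fun y => ENNReal.ofReal (Φ.val (a y)) :=
    (Φ.measurable_val_comp hcont.measurable ha0).ennreal_ofReal
  have hHm : Measurable H := (hΦm.const_mul _).add_const _
  set G := Ω.indicator H with hG
  have hGm : Measurable G := hHm.indicator hΩ
  have hGint : ∫⁻ y, G y ≤ 1 + c + ENNReal.ofReal m := by
    rw [hG, lintegral_indicator hΩ, hH, lintegral_add_right _ measurable_const,
      lintegral_const_mul _ hΦm]
    refine add_le_add (mul_le_of_le_one_right' hint) ?_
    simpa using hm
  have hpt : ∀ y, ∀ r : ℝ, 0 < r → ENNReal.ofReal (a y) ≤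
      ENNReal.ofReal (r ^ (N - 1)) * G y + (Ioo (0 : ℝ) 1).indicator (Φ.growthInv N) r := by
    intro y r hr
    by_cases hy : y ∈ Ω
    -- The weight `1 + c` and the summand `1` of `H` serve the radii below and above `1` at once.
    · rw [hG, indicator_of_mem hy]
      rcases lt_or_ge r 1 with h1 | h1
      · rw [indicator_of_mem (show r ∈ Ioo (0 : ℝ) 1 from ⟨hr, h1⟩)]
        refine (Φ.ofReal_le_pow_mul_val_add N hN (ha0 y) hr).trans ?_
        gcongr
        exact (le_mul_of_one_le_left' le_self_add).trans le_self_add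
      · refine le_add_right ((Φ.ofReal_le_val_div_add_one (ha0 y)).trans ?_)
        refine le_trans ?_ (le_mul_of_one_le_left' (by simpa using one_le_pow₀ h1))
        simp only [hH]
        gcongr
        exact le_add_self
    · simp [haΩ y hy]
  have hray : ∀ ω : Metric.sphere (0 : EuclideanSpace ℝ (Fin N)) 1, ‖u x‖ₑ ≤ ENNReal.ofReal l *
      ((∫⁻ r in Ioi (0 : ℝ), ENNReal.ofReal (r ^ (N - 1)) * G (x + r • (ω : _))) + A) := by
    intro ω
    have hA' : A = ∫⁻ r in Ioi (0 : ℝ), (Ioo (0 : ℝ) 1).indicator (Φ.growthInv N) r := by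
      rw [setLIntegral_indicator measurableSet_Ioo, inter_eq_left.2 Ioo_subset_Ioi_self]
    have hω : ‖(ω : EuclideanSpace ℝ (Fin N))‖ = 1 := by simp
    refine (enorm_le_lintegral_enorm_fderiv_ray hu1 hu2 x hω).trans ?_
    rw [hA', ← lintegral_add_left (by fun_prop), ← lintegral_const_mul' _ _ ENNReal.ofReal_ne_top]
    refine setLIntegral_mono' measurableSet_Ioi fun r hr => ?_
    refine le_trans (le_of_eq ?_) (mul_le_mul_right (hpt (x + r • (ω : _)) r hr) _)
    rw [← ENNReal.ofReal_mul hl.le, ← ofReal_norm]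
    simp only [ha]
    rw [mul_div_cancel₀ _ hl.ne']
  have hav : ‖u x‖ₑ * S ≤ ENNReal.ofReal l * (1 + c + ENNReal.ofReal m + A * S) := by
    rw [hS, ← lintegral_const]
    refine (lintegral_mono hray).trans ?_
    rw [lintegral_const_mul' _ _ ENNReal.ofReal_ne_top, lintegral_add_right _ measurable_const,
      lintegral_const]
    gcongr
    refine le_trans (le_of_eq ?_) hGint
    rw [← lintegral_add_left_eq_self G x, lintegral_eq_lintegral_toSphere volume
      (G := fun y => G (x + y)) (hGm.comp (measurable_const_add x)), finrank_euclideanSpace_fin]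
  have hfin : ‖u x‖ₑ ≤ ENNReal.ofReal l * Q := by
    rw [hQ, ← mul_div_assoc]
    exact (ENNReal.le_div_iff_mul_le (Or.inl hS0) (Or.inl hSt)).2 hav
  have h := ENNReal.toReal_mono (ENNReal.mul_ne_top ENNReal.ofReal_ne_top hQt) hfin
  rw [ENNReal.toReal_mul, ENNReal.toReal_ofReal hl.le, toReal_enorm, Real.norm_eq_abs] at h
  linarith

/-! ### The modular inequalities -/

lemma norm_gradient_eq_norm_fderiv {N : ℕ} (u : EuclideanSpace ℝ (Fin N) → ℝ)
    (x : EuclideanSpace ℝ (Fin N)) : ‖∇ u x‖ = ‖fderiv ℝ u x‖ := by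
  rw [← toDual_gradient, LinearIsometryEquiv.norm_map]

lemma YoungFunction.integrableOn_val_norm_gradient {N : ℕ} (Φ : YoungFunction)
    {Ω : Set (EuclideanSpace ℝ (Fin N))} (hΩ : volume Ω < ∞) {u : EuclideanSpace ℝ (Fin N) → ℝ}
    (hu : u ∈ C1c Ω) : IntegrableOn (fun x => Φ.val ‖∇ u x‖) Ω := by
  simp_rw [norm_gradient_eq_norm_fderiv]
  have hcont := hu.1.continuous_fderiv one_ne_zero
  obtain ⟨b, hb⟩ := (hu.2.1.fderiv ℝ).exists_bound_of_continuous hcont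
  refine Measure.integrableOn_of_bounded (M := Φ.val b) hΩ.ne
    (Φ.measurable_val_comp hcont.norm.measurable fun _ => norm_nonneg _).aestronglyMeasurable
    (Filter.Eventually.of_forall fun x => ?_)
  rw [Real.norm_of_nonneg (Φ.val_nonneg (norm_nonneg _))]
  exact Φ.monotoneOn_val (mem_Ici.2 (norm_nonneg _)) (mem_Ici.2 ((norm_nonneg _).trans (hb x)))
    (hb x)

/-- The supremum bound in modular form. The supermultiplicativity of `Φ` turns the Luxemburg form
into this one. -/
lemma YoungFunction.exists_forall_abs_le_inv (N : ℕ) (hN : 2 ≤ N) (Φ : YoungFunction)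
    (hΦ : DeltaPrime Φ.compl) (hgrowth : SupercriticalGrowth N Φ) (m : ℝ) :
    ∃ K : ℝ, 0 < K ∧ ∀ Ω : Set (EuclideanSpace ℝ (Fin N)), MeasurableSet Ω →
      volume Ω ≤ ENNReal.ofReal m → ∀ u ∈ C1c Ω, ∀ x,
        |u x| ≤ K * Φ.inv (∫ x in Ω, Φ.val ‖∇ u x‖) := by
  obtain ⟨K, hK, hsup⟩ := Φ.exists_forall_abs_le N hN hgrowth m
  obtain ⟨C, hC, hmul⟩ := Φ.exists_val_mul_val_le hΦ
  refine ⟨K * C, by positivity, fun Ω hΩ hm u hu x => ?_⟩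
  have hint := Φ.integrableOn_val_norm_gradient (hm.trans_lt ENNReal.ofReal_lt_top) hu
  set I := ∫ x in Ω, Φ.val ‖∇ u x‖ with hI
  have hI' : ∫⁻ x in Ω, ENNReal.ofReal (Φ.val ‖∇ u x‖) = ENNReal.ofReal I :=
    (ofReal_integral_eq_lintegral_ofReal hint
      (Filter.Eventually.of_forall fun x => Φ.val_nonneg (norm_nonneg _))).symm
  -- Working with `T > Φ⁻¹ I` covers the case `I = 0` and needs no continuity of the inverse.
  have key : ∀ T, Φ.inv I < T → |u x| ≤ K * C * T := by
    intro T hT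
    have hT0 : 0 < T := (Φ.inv_nonneg I).trans_lt hT
    have hΦT := Φ.val_pos hT0
    rw [mul_assoc]
    refine hsup Ω hΩ hm u hu (C * T) (by positivity) ?_ x
    have hpt : ∀ y, ENNReal.ofReal (Φ.val (‖fderiv ℝ u y‖ / (C * T))) ≤
        ENNReal.ofReal (Φ.val T)⁻¹ * ENNReal.ofReal (Φ.val ‖∇ u y‖) := by
      intro y
      rw [← ENNReal.ofReal_mul (by positivity), norm_gradient_eq_norm_fderiv]
      refine ENNReal.ofReal_le_ofReal ?_
      have h := hmul (‖fderiv ℝ u y‖ / (C * T)) T (by positivity) hT0.le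
      have h2 : C * (‖fderiv ℝ u y‖ / (C * T) * T) = ‖fderiv ℝ u y‖ := by field_simp
      rw [h2] at h
      rwa [inv_mul_eq_div, le_div_iff₀ hΦT]
    refine (lintegral_mono hpt).trans ?_
    rw [lintegral_const_mul' _ _ ENNReal.ofReal_ne_top, hI', ← ENNReal.ofReal_mul (by positivity),
      ← ENNReal.ofReal_one]
    refine ENNReal.ofReal_le_ofReal ?_
    rw [inv_mul_eq_div, div_le_one hΦT]
    exact (Φ.lt_val_of_inv_lt hT).le
  have hc : ContinuousWithinAt (fun T : ℝ => K * C * T) (Ioi (Φ.inv I)) (Φ.inv I) := by fun_prop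
  exact ge_of_tendsto hc (eventually_nhdsWithin_of_forall key)

/-- A function bounded by `B` contributes at most `Ψ⁻¹ (‖g‖₁ Ψ B)` to the left side. -/
lemma YoungFunction.integrableOn_and_inv_integral_le {N : ℕ} (Ψ : YoungFunction)
    {Ω : Set (EuclideanSpace ℝ (Fin N))} {g u : EuclideanSpace ℝ (Fin N) → ℝ}
    (hg : IntegrableOn g Ω) (hu : Continuous u) {B : ℝ} (hB : ∀ x, |u x| ≤ B) :
    IntegrableOn (fun x => |g x| * Ψ.val |u x|) Ω ∧
      Ψ.inv (∫ x in Ω, |g x| * Ψ.val |u x|) ≤ Ψ.inv ((∫ x in Ω, |g x|) * Ψ.val B) := by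
  have hle : ∀ x, Ψ.val |u x| ≤ Ψ.val B := fun x =>
    Ψ.monotoneOn_val (mem_Ici.2 (abs_nonneg _)) (mem_Ici.2 ((abs_nonneg _).trans (hB x))) (hB x)
  have hint : IntegrableOn (fun x => |g x| * Ψ.val |u x|) Ω := by
    refine hg.abs.mul_bdd (c := Ψ.val B)
      (Ψ.measurable_val_comp hu.abs.measurable fun _ => abs_nonneg _).aestronglyMeasurable
      (Filter.Eventually.of_forall fun x => ?_)
    rw [Real.norm_of_nonneg (Ψ.val_nonneg (abs_nonneg _))]
    exact hle x
  refine ⟨hint, Ψ.inv_mono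
    (integral_nonneg fun x => mul_nonneg (abs_nonneg _) (Ψ.val_nonneg (abs_nonneg _))) ?_⟩
  rw [← integral_mul_const]
  exact integral_mono hint (hg.abs.mul_const _) fun x =>
    mul_le_mul_of_nonneg_left (hle x) (abs_nonneg _)

theorem mainTheorem6 (N : ℕ) (hN : 2 ≤ N) (Φ Ψ : YoungFunction)
    (hΦ : Φ.Delta2) (hΨ : Ψ.Delta2) (hΦ' : DeltaPrime Φ.compl)
    (hgrowth : SupercriticalGrowth N Φ) (m : ℝ) :
    ∃ C₁ : ℝ, 0 < C₁ ∧
      ∀ Ω : Set (EuclideanSpace ℝ (Fin N)), IsOpen Ω → Bornology.IsBounded Ω →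
        volume Ω ≤ ENNReal.ofReal m →
        ∀ g : EuclideanSpace ℝ (Fin N) → ℝ, IntegrableOn g Ω →
          ModularInequality Φ Ψ Ω g
            (C₁ * max (∫ x in Ω, |g x|) ((∫ x in Ω, |g x|) ^ (1 / Ψ.index))) ∧
          (DeltaPrime Ψ.compl →
            ModularInequality Φ Ψ Ω g (C₁ * Ψ.inv (∫ x in Ω, |g x|))) := by
  obtain ⟨K, hK, hsup⟩ := Φ.exists_forall_abs_le_inv N hN hΦ' hgrowth m
  have hL : ∃ L : ℝ, 1 ≤ L ∧ (DeltaPrime Ψ.compl →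
      ∀ a t : ℝ, 0 ≤ t → Ψ.inv (a * Ψ.val t) ≤ L * (Ψ.inv a * t)) := by
    by_cases h : DeltaPrime Ψ.compl
    · obtain ⟨L, hL, hL'⟩ := Ψ.exists_inv_mul_val_le h
      exact ⟨L, hL.le, fun _ => hL'⟩
    · exact ⟨1, le_rfl, fun h' => absurd h' h⟩
  obtain ⟨L, hL1, hL⟩ := hL
  refine ⟨L * K, by positivity, fun Ω hΩ _ hm g hg => ⟨fun u hu => ?_, fun hΨ' u hu => ?_⟩⟩
  -- The finiteness claims and the passage to `Ψ⁻¹ (‖g‖₁ Ψ B)` are common to both inequalities.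
  all_goals
    have hu' := hsup Ω hΩ.measurableSet hm u hu
    have h1 := Ψ.integrableOn_and_inv_integral_le hg hu.1.continuous hu'
    refine ⟨h1.1, Φ.integrableOn_val_norm_gradient (hm.trans_lt ENNReal.ofReal_lt_top) hu,
      h1.2.trans ?_⟩
    have hI0 := Φ.inv_nonneg (∫ x in Ω, Φ.val ‖∇ u x‖)
    have ha0 : 0 ≤ ∫ x in Ω, |g x| := integral_nonneg fun x => abs_nonneg _
  · refine (Ψ.inv_mul_val_le_max hΨ ha0 (by positivity)).trans ?_
    have h3 : 0 ≤ max (∫ x in Ω, |g x|) ((∫ x in Ω, |g x|) ^ (1 / Ψ.index)) *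
        (K * Φ.inv (∫ x in Ω, Φ.val ‖∇ u x‖)) := by positivity
    exact (le_mul_of_one_le_left h3 hL1).trans_eq (by ring)
  · exact (hL hΨ' _ _ (by positivity)).trans_eq (by ring)
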